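/- Conventions. Write $\bar 0=1$, $\bar 1=0$. Let $\theta$ be a binary substitution of constant length $r$, $\theta(0)=a_0a_1\cdots a_{r-1}$, $\theta(1)=\bar a_0\bar a_1\cdots\bar a_{r-1}$, which is continuous, that is, admissible: no right-infinite fixed point of $\theta$ is periodic. Assume that $\theta$ is in standard form, $a_0=a_{r-1}=0$. Let $j=\min\{m: a_m=1\}$ and $p=jr+j$. Let $z\in\{0,1\}^{\mathbb Z}$ be a bi-infinite fixed point of $\theta$ (that is, $z_{rk+i}=\theta(z_k)_i$ for $k\in\mathbb Z$, $0\le i<r$), let $X_\theta$ be its orbit closure under the shift $\sigma$, $\sigma(x)_k=x_{k+1}$, and for $S=\mathbb Z,\ \mathbb Z_{\ge0},\ \mathbb Z_{\le0}$ let $E_S$ be the closure of $\{\sigma^n:n\in S\}$ in $X_\theta^{X_\theta}$ (product topology); $E=E_{\mathbb Z}$ is the Ellis semigroup of $(X_\theta,\sigma)$. A minimal idempotent is an idempotent of $E$ that lies in a minimal left ideal of $E$. The IP set generated by an infinite set $G\subset\mathbb Z$ is the set $FS(G)$ of all sums of finitely many (at least one) distinct elements of $G$. An element $f$ of $E_S$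 is an IP cluster point (IPCP) along $P\subseteq\mathbb Z$ for the $S$-action if for every neighbourhood $U$ of $f$ there is an IP set $Q_U\subseteq\{n\in P:\sigma^n\in U\}$. Statement. (0) For all letters $a,b$ there is exactly one bi-infinite fixed point $x_{ab}$ of $\theta$ with $(x_{ab})_{-1}=a$ and $(x_{ab})_0=b$, and all four of them lie in $X_\theta$. There is a minimal idempotent $g_1$ of $E$ with $g_1(x_{ab})=x_{bb}$ for all letters $a,b$. In other words, with $v=x_{10}=\ldots1\cdot0\ldots$ and $w=x_{00}=\ldots0\cdot0\ldots$, the minimal idempotent $g_1$ maps $v,w$ to $w$ and $\bar v,\bar w$ to $\bar w$. Let $g_1$ be any such minimal idempotent, and let $Q^+=\{p\,r^{2m}:m\in\mathbb N\}$, where $0\in\mathbb N$. Then: (1) $g_1$ is not an IPCP along $FS(Q^+)$, neither for the $\mathbb Z$-action nor for the $\mathbb Z_{\ge0}$-action. (2) $g_1$ is not an IPCP along any IP set of negative integers, neither for the $\mathbb Z$-action nor for the $\mathbb Z_{\le0}$-action. (3) Let $G=\{n\in\mathbb Z:n<0\}\cup Q^+$. Then $Q^+$, which is the set of the positive elements of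 $G$, is infinite, the negative elements of $G$ are all the negative integers, and $FS(G)=\mathbb Z$. Moreover $g_1$ is an IPCP along $\mathbb Z$ for the $\mathbb Z$-action. (4) Consequently $g_1$ and $\mathbb Z=FS(G)$ are a counterexample to the following claim (Proposition 3.4 of Haddad and Johnson): $f$ is an IPCP for the $\mathbb Z$-action along $FS(G)$ if and only if $G$ has infinitely many positive elements and $f$ is an IPCP for the $\mathbb Z_{\ge0}$-action along the IP set generated by them, or $G$ has infinitely many negative elements and $f$ is an IPCP for the $\mathbb Z_{\le0}$-action along the IP set generated by them. -/

import Mathlib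

open Set Topology

/-! ### The shift and orbit closures -/

/-- The shift `σ(x)_k = x_{k+1}` on bi-infinite words. -/
def biShift (A : Type*) [TopologicalSpace A] : (ℤ → A) ≃ₜ (ℤ → A) where
  toFun x k := x (k + 1)
  invFun x k := x (k - 1)
  left_inv x := by funext k; simp
  right_inv x := by funext k; simp
  continuous_toFun := by fun_prop
  continuous_invFun := by fun_prop

/-- The two-sided orbit of a bi-infinite word under the shift. -/
def shiftOrbit {A : Type*} (z : ℤ → A) : Set (ℤ → A) :=
  range fun (n : ℤ) (k : ℤ) => z (k + n)

/-- The closure of the orbit of `z` in the product topology. -/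
def orbitClosure {A : Type*} [TopologicalSpace A] (z : ℤ → A) : Set (ℤ → A) :=
  closure (shiftOrbit z)

theorem biShift_image_shiftOrbit {A : Type*} [TopologicalSpace A] (z : ℤ → A) :
    biShift A '' shiftOrbit z = shiftOrbit z := by
  ext x
  constructor
  · rintro ⟨_, ⟨n, rfl⟩, rfl⟩
    refine ⟨n + 1, funext fun k => ?_⟩
    change z (k + (n + 1)) = z (k + 1 + n)
    congr 1
    ring
  · rintro ⟨n, rfl⟩
    refine ⟨_, ⟨n - 1, rfl⟩, funext fun k => ?_⟩
    change z (k + 1 + (n - 1)) = z (k + n)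
    congr 1
    ring

theorem mem_orbitClosure_iff {A : Type*} [TopologicalSpace A] (z x : ℤ → A) :
    x ∈ orbitClosure z ↔ biShift A x ∈ orbitClosure z := by
  have h : biShift A '' orbitClosure z = orbitClosure z := by
    rw [orbitClosure, Homeomorph.image_closure, biShift_image_shiftOrbit]
  constructor
  · intro hx
    rw [← h]
    exact mem_image_of_mem _ hx
  · intro hx
    rw [← h] at hx
    obtain ⟨y, hy, hyx⟩ := hx
    rwa [← (biShift A).injective hyx]

/-- The shift as a homeomorphism of the orbit closure of `z`. -/
def orbitShift {A : Type*} [TopologicalSpace A] (z : ℤ → A) :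
    orbitClosure z ≃ₜ orbitClosure z :=
  (biShift A).subtype (mem_orbitClosure_iff z)

/-! ### Substitutions of constant length

A substitution of constant length `r` over `A` is a map `θ : A → (Fin r → A)`; the letter
with index `i` of the block `θ(a)` is `θ a i`. -/

/-- `ω` is a right-infinite fixed point of `θ`: `ω` is the concatenation `θ(ω₀)θ(ω₁)…`. -/
def IsRightFixed {A : Type*} {r : ℕ} (θ : A → Fin r → A) (ω : ℕ → A) : Prop :=
  ∀ (k : ℕ) (i : Fin r), ω (r * k + i) = θ (ω k) i

/-- `x` is a bi-infinite fixed point of `θ`: `x = …θ(x₋₁) · θ(x₀)θ(x₁)…`. -/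
def IsBiFixed {A : Type*} {r : ℕ} (θ : A → Fin r → A) (x : ℤ → A) : Prop :=
  ∀ (k : ℤ) (i : Fin r), x (r * k + i) = θ (x k) i

/-- A right-infinite word is periodic. -/
def IsPeriodicWord {A : Type*} (ω : ℕ → A) : Prop :=
  ∃ d : ℕ, 0 < d ∧ ∀ n, ω (n + d) = ω n

/-- `θ` is admissible: distinct letters have distinct images and fixed points of `θ` are not
periodic words. -/
def IsAdmissible {A : Type*} {r : ℕ} (θ : A → Fin r → A) : Prop :=
  Function.Injective θ ∧ ∀ ω : ℕ → A, IsRightFixed θ ω → ¬ IsPeriodicWord ω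

/-- Every block `θ(a)` begins and ends with the letter `a`. -/
def IsStandardForm {A : Type*} {r : ℕ} (θ : A → Fin r → A) : Prop :=
  ∀ (a : A) (i : Fin r), ((i : ℕ) = 0 ∨ (i : ℕ) + 1 = r) → θ a i = a

/-- A continuous substitution: binary (`false` is the letter `0`, `true` is the letter `1`), of
constant length, admissible, and `θ(0)` is the dual of `θ(1)`. -/
def IsContinuousSubst {r : ℕ} (θ : Bool → Fin r → Bool) : Prop :=
  IsAdmissible θ ∧ ∀ i, θ false i = !(θ true i)

/-! ### Ellis semigroups -/

/-- For `S = ℤ`, `S = {n ≥ 0}` or `S = {n ≤ 0}`: the Ellis semigroup of the action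
`{T ^ n : n ∈ S}`, that is the closure of this set in `X → X` with the product topology. -/
def ellisSemigroup {X : Type*} [TopologicalSpace X] (T : X ≃ₜ X) (S : Set ℤ) : Set (X → X) :=
  closure {f | ∃ n ∈ S, f = ⇑(T ^ n)}

/-- `L` is a (nonempty) left ideal of the composition semigroup `E`. -/
def IsLeftIdealOf {X : Type*} (E L : Set (X → X)) : Prop :=
  L ⊆ E ∧ L.Nonempty ∧ ∀ p ∈ E, ∀ q ∈ L, p ∘ q ∈ L

/-- `L` is a minimal left ideal of `E`. -/
def IsMinimalLeftIdealOf {X : Type*} (E L : Set (X → X)) : Prop :=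
  IsLeftIdealOf E L ∧ ∀ K, IsLeftIdealOf E K → K ⊆ L → K = L

/-- `u` is a minimal idempotent of `E`. -/
def IsMinimalIdempotentOf {X : Type*} (E : Set (X → X)) (u : X → X) : Prop :=
  u ∘ u = u ∧ ∃ L, IsMinimalLeftIdealOf E L ∧ u ∈ L

/-! ### IP sets and IP cluster points -/

/-- The set of sums of finitely many (at least one) distinct elements of `G`. -/
def finiteSums (G : Set ℤ) : Set ℤ :=
  {n | ∃ F : Finset ℤ, F.Nonempty ∧ ↑F ⊆ G ∧ n = ∑ m ∈ F, m}

/-- An IP set of integers: the set of finite sums of the terms of a sequence of distinct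
integers, which is the set of finite sums of an infinite set of integers. -/
def IsIPSet (P : Set ℤ) : Prop :=
  ∃ G : Set ℤ, G.Infinite ∧ P = finiteSums G

/-- `f` is an IP cluster point, for the action `{T ^ n : n ∈ S}`, along the set `P` of integers.
Since an IP set is infinite, every neighbourhood of such an `f` contains `T ^ n` for infinitely
many `n`, so that `f` is a cluster point. -/
def IsIPCP {X : Type*} [TopologicalSpace X] (T : X ≃ₜ X) (S P : Set ℤ) (f : X → X) : Prop :=
  f ∈ ellisSemigroup T S ∧
    ∀ U ∈ 𝓝 f, ∃ Q : Set ℤ, IsIPSet Q ∧ Q ⊆ {n | n ∈ P ∧ ⇑(T ^ n) ∈ U}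

/-- The equivalence claimed by Haddad and Johnson for a map `f` and the IP set generated by `G`:
`f` is an IP cluster point of the `ℤ`-cascade along this set if and only if there are infinitely
many positive generators and `f` is an IP cluster point of the forward action along the IP set
generated by them, or the same with negative generators and the backward action. -/
def HaddadJohnsonEquivalence {X : Type*} [TopologicalSpace X] (T : X ≃ₜ X) (G : Set ℤ)
    (f : X → X) : Prop :=
  IsIPCP T univ (finiteSums G) f ↔
    (((G ∩ Ioi 0).Infinite ∧ IsIPCP T (Ici 0) (finiteSums (G ∩ Ioi 0)) f) ∨
      ((G ∩ Iio 0).Infinite ∧ IsIPCP T (Iic 0) (finiteSums (G ∩ Iio 0)) f))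

/-! ### The idempotent -/

/-- `g` is a minimal idempotent of the Ellis semigroup of the `ℤ`-cascade on the orbit closure of
`z` and it sends each fixed point `…a · b…` of `θ` to the fixed point `…b · b…`. -/
def IsG1 {r : ℕ} (θ : Bool → Fin r → Bool) (z : ℤ → Bool)
    (g : orbitClosure z → orbitClosure z) : Prop :=
  IsMinimalIdempotentOf (ellisSemigroup (orbitShift z) univ) g ∧
    ∀ x y : orbitClosure z, IsBiFixed θ x.1 → IsBiFixed θ y.1 →
      y.1 0 = x.1 0 → y.1 (-1) = x.1 0 → g x = y

/-! ### Powers of the shift -/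

/-! Since `θ(1)` is the dual of `θ(0)`, all fixed points agree, up to exchanging the letters, on
aligned blocks of length `r ^ m` (`IsBiFixed.block`); everything about the words rests on this
self-similarity.

Existence of `g₁`: shifts by `N * r ^ m`, where `N` follows two equal letters, accumulate at a map
with the prescribed values. Recurrence carries these values into a minimal left ideal, and the
Ellis–Numakura lemma supplies an idempotent there.

Obstructions: every `n ∈ FS(Q⁺)` satisfies `w (n - 1) = 1` (`IsBiFixed.apply_sum_sub_one`), whereas
`g₁ w = w` has `0` at `-1`. For `n < 0` the letters `v n` and `w n` differ, whereas `g₁` sends both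
words to `w`. So suitable neighbourhoods of `g₁` contain no such power of the shift.

Along `ℤ` itself, idempotency gives IP sets (`isIPCP_univ_of_idempotent`), and mixed signs make
`FS(G)` all of `ℤ`. -/

theorem orbitShift_zpow_apply {A : Type*} [TopologicalSpace A] (z : ℤ → A) (n : ℤ)
    (x : orbitClosure z) (k : ℤ) : ((orbitShift z ^ n) x).1 k = x.1 (k + n) := by
  induction n using Int.induction_on generalizing x k with
  | zero => simp
  | succ n ih =>
    rw [zpow_add_one]
    change ((orbitShift z ^ (n : ℤ)) (orbitShift z x)).1 k = _
    rw [ih]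
    change x.1 (k + n + 1) = _
    rw [add_assoc]
  | pred n ih =>
    have h := ih x k
    rw [zpow_sub_one]
    change ((orbitShift z ^ (-(n : ℤ))) ((orbitShift z)⁻¹ x)).1 k = _
    rw [ih]
    change x.1 (k + -n - 1) = _
    rw [add_sub_assoc]

theorem continuous_coord {A : Type*} [TopologicalSpace A] {z : ℤ → A} (x : orbitClosure z)
    (k : ℤ) : Continuous fun f : orbitClosure z → orbitClosure z => (f x).1 k :=
  (continuous_apply k).comp (continuous_subtype_val.comp (continuous_apply x))

instance orbitClosure_compactSpace {A : Type*} [TopologicalSpace A] [CompactSpace A]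
    (z : ℤ → A) : CompactSpace (orbitClosure z) :=
  isCompact_iff_compactSpace.1 isClosed_closure.isCompact

/-! ### Ellis semigroups -/

section Ellis

variable {X : Type*} [TopologicalSpace X] (T : X ≃ₜ X)

theorem zpow_mem_ellisSemigroup (n : ℤ) : ⇑(T ^ n) ∈ ellisSemigroup T univ :=
  subset_closure ⟨n, mem_univ _, rfl⟩

theorem isClosed_ellisSemigroup (S : Set ℤ) : IsClosed (ellisSemigroup T S) := isClosed_closure

theorem continuous_precomp (q : X → X) : Continuous fun f : X → X => f ∘ q :=
  continuous_pi fun x => continuous_apply (q x)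

theorem continuous_postcomp {h : X → X} (hh : Continuous h) :
    Continuous fun f : X → X => h ∘ f :=
  continuous_pi fun x => hh.comp (continuous_apply x)

/-- `f ↦ h ∘ f` is continuous only for continuous `h`, so the right factor is first taken to the
limit against powers of `T`, and then the left factor. -/
theorem comp_mem_ellisSemigroup {p q : X → X} (hp : p ∈ ellisSemigroup T univ)
    (hq : q ∈ ellisSemigroup T univ) : p ∘ q ∈ ellisSemigroup T univ := by
  have hT : ∀ n : ℤ, ⇑(T ^ n) ∘ q ∈ ellisSemigroup T univ := fun n =>
    closure_minimal (t := (fun f : X → X => ⇑(T ^ n) ∘ f) ⁻¹' ellisSemigroup T univ)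
      (by
        rintro _ ⟨m, -, rfl⟩
        change ⇑(T ^ n) ∘ ⇑(T ^ m) ∈ ellisSemigroup T univ
        rw [show ⇑(T ^ n) ∘ ⇑(T ^ m) = ⇑(T ^ (n + m)) by rw [zpow_add]; rfl]
        exact zpow_mem_ellisSemigroup T _)
      ((isClosed_ellisSemigroup T _).preimage (continuous_postcomp (T ^ n).continuous)) hq
  exact closure_minimal (s := {f | ∃ n ∈ (univ : Set ℤ), f = ⇑(T ^ n)})
    (t := (fun f : X → X => f ∘ q) ⁻¹' ellisSemigroup T univ)
    (by rintro _ ⟨m, -, rfl⟩; exact hT m)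
    ((isClosed_ellisSemigroup T _).preimage (continuous_precomp q)) hp

theorem isLeftIdealOf_comp {q : X → X} (hq : q ∈ ellisSemigroup T univ) :
    IsLeftIdealOf (ellisSemigroup T univ) ((fun f => f ∘ q) '' ellisSemigroup T univ) := by
  refine ⟨?_, ⟨q ∘ q, q, hq, rfl⟩, ?_⟩
  · rintro _ ⟨f, hf, rfl⟩
    exact comp_mem_ellisSemigroup T hf hq
  · rintro p hp _ ⟨f, hf, rfl⟩
    exact ⟨p ∘ f, comp_mem_ellisSemigroup T hp hf, rfl⟩

variable [CompactSpace X] [T2Space X]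

theorem isClosed_image_comp (q : X → X) :
    IsClosed ((fun f => f ∘ q) '' ellisSemigroup T univ) :=
  ((isClosed_ellisSemigroup T _).isCompact.image (continuous_precomp q)).isClosed

/-- Every closed left ideal contains a closed minimal left ideal. -/
theorem exists_isMinimalLeftIdealOf_subset {K : Set (X → X)} (hKc : IsClosed K)
    (hK : IsLeftIdealOf (ellisSemigroup T univ) K) :
    ∃ L, L ⊆ K ∧ IsClosed L ∧ IsMinimalLeftIdealOf (ellisSemigroup T univ) L := by
  obtain ⟨L, hLK, hL⟩ := zorn_superset_nonempty
    {L : Set (X → X) | IsClosed L ∧ IsLeftIdealOf (ellisSemigroup T univ) L} (by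
      intro c hc hch hne
      refine ⟨⋂₀ c, ⟨isClosed_sInter fun s hs => (hc hs).1, ?_, ?_, ?_⟩,
        fun s hs => sInter_subset_of_mem hs⟩
      · obtain ⟨s, hs⟩ := hne
        exact (sInter_subset_of_mem hs).trans (hc hs).2.1
      · have := hne.to_subtype
        rw [sInter_eq_iInter]
        refine IsCompact.nonempty_iInter_of_directed_nonempty_isCompact_isClosed _ ?_
          (fun s => (hc s.2).2.2.1) (fun s => (hc s.2).1.isCompact) (fun s => (hc s.2).1)
        intro a b
        rcases hch.total a.2 b.2 with h | h
        · exact ⟨a, Subset.rfl, h⟩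
        · exact ⟨b, h, Subset.rfl⟩
      · exact fun p hp q hq s hs => (hc hs).2.2.2 p hp q (hq s hs)) K ⟨hKc, hK⟩
  refine ⟨L, hLK, hL.prop.1, hL.prop.2, fun J hJ hJL => hJL.antisymm ?_⟩
  obtain ⟨q, hq⟩ := hJ.2.1
  have hqE := hJ.1 hq
  -- `J` need not be closed; the closed left ideal `E ∘ q` inside it is compared with `L` instead.
  have hsub : (fun f => f ∘ q) '' ellisSemigroup T univ ⊆ J := by
    rintro _ ⟨f, hf, rfl⟩
    exact hJ.2.2 f hf q hq
  exact (hL.le_of_le ⟨isClosed_image_comp T q, isLeftIdealOf_comp T hqE⟩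
    (hsub.trans hJL)).trans hsub

theorem exists_idempotent_of_isClosed {S : Set (X → X)} (hne : S.Nonempty) (hc : IsClosed S)
    (hS : ∀ p ∈ S, ∀ q ∈ S, p ∘ q ∈ S) : ∃ u ∈ S, u ∘ u = u := by
  let : Semigroup (X → X) := { mul := fun p q => p ∘ q, mul_assoc := fun _ _ _ => rfl }
  exact exists_idempotent_in_compact_subsemigroup (M := X → X)
    (fun q => continuous_precomp q) S hne hc.isCompact hS

/-- A sequence of powers of `T` has a cluster point in the Ellis semigroup. -/
theorem exists_mem_ellisSemigroup_of_tendsto (n : ℕ → ℤ) :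
    ∃ f ∈ ellisSemigroup T univ, ∀ x y : X,
      Filter.Tendsto (fun m => (T ^ n m) x) Filter.atTop (𝓝 y) → f x = y := by
  -- A single ultrafilter limit serves all points `x` at once.
  obtain ⟨f, -, hf⟩ := isCompact_univ.ultrafilter_le_nhds
    ((Filter.hyperfilter ℕ).map fun m => (⇑(T ^ n m) : X → X)) (by simp)
  have hf' : Filter.Tendsto (fun m => (⇑(T ^ n m) : X → X)) (Filter.hyperfilter ℕ) (𝓝 f) := hf
  refine ⟨f, (isClosed_ellisSemigroup T _).mem_of_tendsto hf'
    (Filter.Eventually.of_forall fun m => zpow_mem_ellisSemigroup T _), fun x y h => ?_⟩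
  exact tendsto_nhds_unique (((continuous_apply x).tendsto f).comp hf')
    (h.mono_left Nat.hyperfilter_le_atTop)

end Ellis

/-! ### Idempotents are IP cluster points -/

section IPCP

variable {X : Type*} [TopologicalSpace X] [T2Space X] (T : X ≃ₜ X)

/-- Generators are chosen one at a time: `g ∘ g = g` lets every partial sum be followed by a further
power of `T` close to `g`. As `g` is not a power of `T`, the generators can be kept distinct. -/
theorem isIPCP_univ_of_idempotent {g : X → X} (hg : g ∈ ellisSemigroup T univ)
    (hgg : g ∘ g = g) (hne : ∀ n : ℤ, ⇑(T ^ n) ≠ g) : IsIPCP T univ univ g := by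
  classical
  refine ⟨hg, fun U hU => ?_⟩
  obtain ⟨V, hVU, hVo, hgV⟩ := mem_nhds_iff.1 hU
  -- The second condition makes `W` stable: if `T ^ n ∈ W`, then `T ^ n ∘ g ∈ W`.
  let W : Set (X → X) := V ∩ {f | f ∘ g ∈ V}
  have hWo : IsOpen W := hVo.inter (hVo.preimage (continuous_precomp g))
  have hgW : g ∈ W := ⟨hgV, by change g ∘ g ∈ V; rwa [hgg]⟩
  have hWg : ∀ n : ℤ, ⇑(T ^ n) ∈ W → ⇑(T ^ n) ∘ g ∈ W := fun n hn =>
    ⟨hn.2, by change (⇑(T ^ n) ∘ g) ∘ g ∈ V; rw [Function.comp_assoc, hgg]; exact hn.2⟩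
  let P : Finset ℤ → Prop := fun F => ∀ s ⊆ F, s.Nonempty → ⇑(T ^ (∑ m ∈ s, m)) ∈ W
  have step : ∀ F : Finset ℤ, P F → ∃ n ∉ F, P (insert n F) := by
    intro F hF
    let O : Set (X → X) := W ∩ (⋂ s ∈ F.powerset.filter Finset.Nonempty,
      {f | ⇑(T ^ (∑ m ∈ s, m)) ∘ f ∈ W}) ∩ ⋂ n ∈ F, {⇑(T ^ n)}ᶜ
    have hO : IsOpen O := by
      refine (hWo.inter (isOpen_biInter_finset fun s _ =>
        hWo.preimage (continuous_postcomp (T ^ _).continuous))).inter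
        (isOpen_biInter_finset fun n _ => isOpen_compl_singleton)
    have hgO : g ∈ O := by
      refine ⟨⟨hgW, ?_⟩, ?_⟩
      · simp only [mem_iInter, Finset.mem_filter, Finset.mem_powerset]
        exact fun s hs => hWg _ (hF s hs.1 hs.2)
      · simp only [mem_iInter]
        exact fun n _ h => hne n h.symm
    obtain ⟨_, hfO, n, -, rfl⟩ := mem_closure_iff.1 hg O hO hgO
    obtain ⟨⟨hnW, h1⟩, h2⟩ := hfO
    simp only [mem_iInter, Finset.mem_filter, Finset.mem_powerset] at h1 h2
    have hnF : n ∉ F := fun h => h2 n h rfl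
    refine ⟨n, hnF, fun s hs hsne => ?_⟩
    by_cases hns : n ∈ s
    · rw [← Finset.add_sum_erase s _ hns, add_comm]
      have hsub : s.erase n ⊆ F := by
        rw [← Finset.subset_insert_iff]; exact hs
      rcases (s.erase n).eq_empty_or_nonempty with he | he
      · rwa [he, Finset.sum_empty, zero_add]
      · rw [zpow_add]
        exact h1 _ ⟨hsub, he⟩
    · exact hF s ((Finset.subset_insert_iff_of_notMem hns).1 hs) hsne
  choose! next hnext hP using step
  obtain ⟨F, hF0, hFs⟩ : ∃ F : ℕ → Finset ℤ, F 0 = ∅ ∧ ∀ k, F (k + 1) = insert (next (F k)) (F k) :=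
    ⟨fun k => Nat.rec ∅ (fun _ s => insert (next s) s) k, rfl, fun _ => rfl⟩
  have hF : ∀ k, P (F k) := by
    intro k
    induction k with
    | zero =>
      intro s hs hsne
      rw [hF0] at hs
      exact absurd (Finset.subset_empty.1 hs) hsne.ne_empty
    | succ k ih => exact hFs k ▸ hP _ ih
  have hmono : Monotone F := monotone_nat_of_le_succ fun k =>
    hFs k ▸ Finset.subset_insert _ _
  have hcard : ∀ k, (F k).card = k := by
    intro k
    induction k with
    | zero => rw [hF0, Finset.card_empty]
    | succ k ih => rw [hFs, Finset.card_insert_of_notMem (hnext _ (hF k)), ih]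
  refine ⟨_, ⟨⋃ k, {n | n ∈ F k}, fun hfin => ?_, rfl⟩, ?_⟩
  · have h := Finset.card_le_card (s := F (hfin.toFinset.card + 1)) (t := hfin.toFinset)
      (fun x hx => hfin.mem_toFinset.2 (mem_iUnion.2 ⟨hfin.toFinset.card + 1, hx⟩))
    rw [hcard] at h
    omega
  · rintro _ ⟨s, hsne, hs, rfl⟩
    refine ⟨mem_univ _, hVU ?_⟩
    have hd : Directed (· ⊆ ·) fun k => {n | n ∈ F k} := fun a b =>
      ⟨max a b, Finset.coe_subset.2 (hmono (le_max_left a b)),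
        Finset.coe_subset.2 (hmono (le_max_right a b))⟩
    obtain ⟨k, hk⟩ := hd.exists_mem_subset_of_finset_subset_biUnion hs
    exact (hF k s (by exact_mod_cast hk) hsne).1

end IPCP

/-! ### Fixed points of continuous substitutions -/

section Substitution

variable {r : ℕ} {θ : Bool → Fin r → Bool}

theorem IsBiFixed.apply_xor (hd : ∀ i, θ false i = !(θ true i)) {x : ℤ → Bool}
    (hx : IsBiFixed θ x) (k : ℤ) (i : Fin r) : x (r * k + i) = xor (x k) (θ false i) := by
  rw [hx k i]
  cases x k <;> simp [hd]

/-- All fixed points agree on blocks of length `r ^ m`, up to the first letter of the block. -/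
theorem IsBiFixed.block (hr : 0 < r) (hd : ∀ i, θ false i = !(θ true i)) {x y : ℤ → Bool}
    (hx : IsBiFixed θ x) (hy : IsBiFixed θ y) (N M : ℤ) (m : ℕ) (k : ℤ) (h0 : 0 ≤ k)
    (hk : k < (r : ℤ) ^ m) :
    xor (x (N * (r : ℤ) ^ m + k)) (x N) = xor (y (M * (r : ℤ) ^ m + k)) (y M) := by
  have hr' : (0 : ℤ) < r := by exact_mod_cast hr
  induction m generalizing k with
  | zero =>
    obtain rfl : k = 0 := by simp at hk; omega
    simp
  | succ m ih =>
    obtain ⟨i, hi⟩ : ∃ i : Fin r, (i : ℤ) = k % r := by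
      have h1 := Int.emod_nonneg k hr'.ne'
      have h2 := Int.emod_lt_of_pos k hr'
      exact ⟨⟨(k % r).toNat, by omega⟩, by simp [h1]⟩
    -- Peels off the last base-`r` digit of `k`, whose contribution is the same for all fixed
    -- points.
    have key : ∀ u : ℤ → Bool, IsBiFixed θ u → ∀ P : ℤ,
        u (P * (r : ℤ) ^ (m + 1) + k) = xor (u (P * (r : ℤ) ^ m + k / r)) (θ false i) := by
      intro u hu P
      rw [← hu.apply_xor hd, hi]
      congr 1
      have := Int.mul_ediv_add_emod k r
      rw [pow_succ]
      linear_combination -this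
    have := ih (k / r) (Int.ediv_nonneg h0 hr'.le)
      (Int.ediv_lt_of_lt_mul hr' (by rwa [pow_succ] at hk))
    rw [key x hx, key y hy, Bool.xor_right_comm, this, Bool.xor_right_comm]

/-- The window consists of the two blocks meeting at `N * r ^ m`, each determined by its first-level
letter. -/
theorem IsBiFixed.eq_of_eq (hr : 1 < r) (hd : ∀ i, θ false i = !(θ true i)) {x y : ℤ → Bool}
    (hx : IsBiFixed θ x) (hy : IsBiFixed θ y) {N : ℤ} (m : ℕ) (h1 : x (N - 1) = y (-1))
    (h0 : x N = y 0) {k : ℤ} (hk : -(r : ℤ) ^ m ≤ k) (hk' : k < (r : ℤ) ^ m) :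
    x (N * (r : ℤ) ^ m + k) = y k := by
  rcases le_or_gt 0 k with h | h
  · have := hx.block (by omega) hd hy N 0 m k h hk'
    rw [h0] at this
    simpa using this
  · have := hx.block (by omega) hd hy (N - 1) (-1) m (k + (r : ℤ) ^ m) (by omega) (by omega)
    rw [h1, show (N - 1) * (r : ℤ) ^ m + (k + (r : ℤ) ^ m) = N * (r : ℤ) ^ m + k by ring,
      show (-1) * (r : ℤ) ^ m + (k + (r : ℤ) ^ m) = k by ring] at this
    simpa using this

theorem exists_abs_lt_pow (hr : 1 < r) (k : ℤ) : ∃ m : ℕ, |k| < (r : ℤ) ^ m := by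
  refine ⟨k.natAbs, ?_⟩
  rw [Int.abs_eq_natAbs]
  exact_mod_cast Nat.lt_pow_self hr

theorem IsBiFixed.ext (hr : 1 < r) (hd : ∀ i, θ false i = !(θ true i)) {x y : ℤ → Bool}
    (hx : IsBiFixed θ x) (hy : IsBiFixed θ y) (h1 : x (-1) = y (-1)) (h0 : x 0 = y 0) :
    x = y := by
  funext k
  obtain ⟨m, hm⟩ := exists_abs_lt_pow hr k
  rw [abs_lt] at hm
  simpa using hx.eq_of_eq hr hd hy (N := 0) m h1 h0 hm.1.le hm.2

/-- Blocks never straddle the origin, so each half of `z` can be dualised independently. -/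
theorem IsBiFixed.exists_of_letters (hd : ∀ i, θ false i = !(θ true i))
    {z : ℤ → Bool} (hz : IsBiFixed θ z) (a b : Bool) :
    ∃ x : ℤ → Bool, IsBiFixed θ x ∧ x (-1) = a ∧ x 0 = b := by
  refine ⟨fun n => if n < 0 then xor (z n) (xor (z (-1)) a) else xor (z n) (xor (z 0) b),
    fun k i => ?_, by simp, by simp⟩
  have hi := i.isLt
  have hneg : (r : ℤ) * k + i < 0 ↔ k < 0 := by
    constructor
    · intro h
      by_contra hk
      have := mul_nonneg (Int.natCast_nonneg r) (not_lt.1 hk)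
      omega
    · intro h
      nlinarith
  have hθ : ∀ a, θ a i = xor a (θ false i) := by
    intro a
    cases a <;> simp [hd]
  simp only [hneg]
  rw [hz.apply_xor hd]
  split_ifs <;> rw [hθ (xor _ _)] <;> rw [Bool.xor_right_comm]

theorem IsStandardForm.one_lt (hstd : IsStandardForm θ) {j : Fin r} (hj : θ false j = true) :
    (0 : ℕ) < j ∧ (j : ℕ) + 1 < r := by
  have := j.isLt
  have h0 : (j : ℕ) ≠ 0 := fun h => by simp [hstd false j (Or.inl h)] at hj
  have h1 : (j : ℕ) + 1 ≠ r := fun h => by simp [hstd false j (Or.inr h)] at hj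
  omega

/-- Every pair of letters occurs consecutively to the right of the origin. -/
theorem IsBiFixed.exists_pair (hθ : IsContinuousSubst θ) (hstd : IsStandardForm θ)
    {j : Fin r} (hj : θ false j = true) {z : ℤ → Bool} (hz : IsBiFixed θ z) (a b : Bool) :
    ∃ k : ℤ, 0 < k ∧ z (k - 1) = a ∧ z k = b := by
  have hd := hθ.2
  obtain ⟨hj0, hjr⟩ := hstd.one_lt hj
  have hr : 1 < r := by omega
  have hzj : z j = !(z 0) := by
    have := hz.apply_xor hd 0 j
    simpa [hj] using this
  -- Block `j` is the dual of block `0`, because `z j ≠ z 0`.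
  have flip : ∀ a b, (∃ k : ℤ, 0 < k ∧ z (k - 1) = a ∧ z k = b) →
      ∃ k : ℤ, 0 < k ∧ z (k - 1) = !a ∧ z k = !b := by
    rintro a b ⟨k, hk, ha, hb⟩
    obtain ⟨m, hm⟩ := exists_abs_lt_pow hr k
    rw [abs_lt] at hm
    have h1 := hz.block (by omega) hd hz j 0 m k (by omega) hm.2
    have h2 := hz.block (by omega) hd hz j 0 m (k - 1) (by omega) (by omega)
    refine ⟨j * (r : ℤ) ^ m + k, by positivity, ?_, ?_⟩
    · rw [hzj] at h2
      rw [add_sub_assoc]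
      simp only [zero_mul, zero_add, ha] at h2
      revert h2
      cases z (j * (r : ℤ) ^ m + (k - 1)) <;> cases z 0 <;> cases a <;> simp
    · rw [hzj] at h1
      simp only [zero_mul, zero_add, hb] at h1
      revert h1
      cases z (j * (r : ℤ) ^ m + k) <;> cases z 0 <;> cases b <;> simp
  have all_of : ∀ s, (∃ k : ℤ, 0 < k ∧ xor (z (k - 1)) (z k) = s) → xor a b = s →
      ∃ k : ℤ, 0 < k ∧ z (k - 1) = a ∧ z k = b := by
    rintro s ⟨k, hk, hs⟩ hab
    by_cases ha : z (k - 1) = a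
    · refine ⟨k, hk, ha, ?_⟩
      rw [← hab, ha] at hs
      revert hs
      cases z k <;> cases a <;> cases b <;> simp
    · have ha' : z (k - 1) = !a := by
        revert ha
        cases z (k - 1) <;> cases a <;> simp
      have hb' : z k = !b := by
        rw [← hab, ha'] at hs
        revert hs
        cases z k <;> cases a <;> cases b <;> simp
      simpa using flip _ _ ⟨k, hk, ha', hb'⟩
  cases hab : xor a b
  · refine all_of false ?_ hab
    -- Without equal neighbours the right half alternates with period 2, against admissibility.
    by_contra! hno
    have halt : ∀ k : ℤ, 0 < k → z k = !(z (k - 1)) := by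
      intro k hk
      have := hno k hk
      revert this
      cases z k <;> cases z (k - 1) <;> simp
    refine hθ.1.2 (fun n : ℕ => z n) (fun k i => ?_) ⟨2, by omega, fun n => ?_⟩
    · have := hz k i
      push_cast
      exact this
    · have h1 := halt (n + 1) (by omega)
      have h2 := halt (n + 2) (by omega)
      rw [show (n : ℤ) + 2 - 1 = n + 1 by ring] at h2
      rw [add_sub_cancel_right] at h1
      push_cast
      simp [h2, h1]
  · refine all_of true ?_ hab
    by_contra! hno
    have hconst : ∀ n : ℕ, z n = z 0 := by
      intro n
      induction n with
      | zero => rfl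
      | succ n ih =>
        have := hno (n + 1) (by omega)
        rw [add_sub_cancel_right, ih] at this
        push_cast
        revert this
        cases z (n + 1) <;> cases z 0 <;> simp
    have := hconst j
    rw [hzj] at this
    simp at this

/-! ### Convergence on windows and recurrence -/

theorem tendsto_zpow_of_window {z : ℤ → Bool} (hr : 1 < r) {x y : orbitClosure z} {n : ℕ → ℤ}
    (h : ∀ (m : ℕ) (k : ℤ), -(r : ℤ) ^ m ≤ k → k < (r : ℤ) ^ m → x.1 (n m + k) = y.1 k) :
    Filter.Tendsto (fun m => (orbitShift z ^ n m) x) Filter.atTop (𝓝 y) := by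
  rw [tendsto_subtype_rng, tendsto_pi_nhds]
  intro k
  obtain ⟨M, hM⟩ := exists_abs_lt_pow hr k
  rw [abs_lt] at hM
  refine tendsto_nhds_of_eventually_eq ?_
  filter_upwards [Filter.eventually_ge_atTop M] with m hm
  have hle : (r : ℤ) ^ M ≤ (r : ℤ) ^ m := by
    exact_mod_cast Nat.pow_le_pow_right (by omega) hm
  rw [orbitShift_zpow_apply, add_comm]
  exact h m k (by omega) (by omega)

theorem mem_orbitClosure_of_window {z y : ℤ → Bool} (hr : 1 < r) {n : ℕ → ℤ}
    (h : ∀ (m : ℕ) (k : ℤ), -(r : ℤ) ^ m ≤ k → k < (r : ℤ) ^ m → z (n m + k) = y k) :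
    y ∈ orbitClosure z := by
  refine mem_closure_of_tendsto (b := Filter.atTop) (f := fun (m : ℕ) (k : ℤ) => z (k + n m)) ?_
    (Filter.Eventually.of_forall fun m => ⟨n m, rfl⟩)
  rw [tendsto_pi_nhds]
  intro k
  obtain ⟨M, hM⟩ := exists_abs_lt_pow hr k
  rw [abs_lt] at hM
  refine tendsto_nhds_of_eventually_eq ?_
  filter_upwards [Filter.eventually_ge_atTop M] with m hm
  have hle : (r : ℤ) ^ M ≤ (r : ℤ) ^ m := by
    exact_mod_cast Nat.pow_le_pow_right (by omega) hm
  rw [add_comm]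
  exact h m k (by omega) (by omega)

theorem IsBiFixed.mem_orbitClosure (hθ : IsContinuousSubst θ) (hstd : IsStandardForm θ)
    {j : Fin r} (hj : θ false j = true) {z : ℤ → Bool} (hz : IsBiFixed θ z)
    {x : ℤ → Bool} (hx : IsBiFixed θ x) : x ∈ orbitClosure z := by
  have hr : 1 < r := by have := hstd.one_lt hj; omega
  obtain ⟨N, -, h1, h0⟩ := hz.exists_pair hθ hstd hj (x (-1)) (x 0)
  exact mem_orbitClosure_of_window hr (n := fun m => N * (r : ℤ) ^ m)
    fun m k hk hk' => hz.eq_of_eq hr hθ.2 hx m h1 h0 hk hk'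

/-- The central blocks of a fixed point occur with bounded gaps in all elements of the
substitution space. -/
theorem IsBiFixed.exists_window (hθ : IsContinuousSubst θ) (hstd : IsStandardForm θ)
    {j : Fin r} (hj : θ false j = true) {z : ℤ → Bool} (hz : IsBiFixed θ z)
    {w : ℤ → Bool} (hw : IsBiFixed θ w) (y : orbitClosure z) (m : ℕ) :
    ∃ d : ℤ, ∀ k, -(r : ℤ) ^ m ≤ k → k < (r : ℤ) ^ m → y.1 (d + k) = w k := by
  have hd := hθ.2
  have hr : 1 < r := by have := hstd.one_lt hj; omega
  have hr' : (0 : ℤ) < r := by omega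
  have hpair : ∃ K : ℕ, ∀ s : Bool, ∃ k : ℤ, 0 < k ∧ k < (r : ℤ) ^ K ∧
      xor (z (k - 1)) s = w (-1) ∧ xor (z k) s = w 0 := by
    have : ∀ s : Bool, ∃ k : ℤ, 0 < k ∧ xor (z (k - 1)) s = w (-1) ∧ xor (z k) s = w 0 := by
      intro s
      obtain ⟨k, hk, h1, h0⟩ := hz.exists_pair hθ hstd hj (xor (w (-1)) s) (xor (w 0) s)
      exact ⟨k, hk, by simp [h1], by simp [h0]⟩
    choose k hk h1 h0 using this
    obtain ⟨K, hK⟩ := exists_abs_lt_pow hr (k false + k true)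
    have := hk false
    have := hk true
    rw [abs_lt] at hK
    refine ⟨K, fun s => ⟨k s, hk s, ?_, h1 s, h0 s⟩⟩
    cases s <;> omega
  obtain ⟨K, hK⟩ := hpair
  have hB : (0 : ℤ) < (r : ℤ) ^ (K + m) := by positivity
  -- Bounding `d` makes the condition closed. One length `r ^ (K + m)` reaches the next aligned
  -- block, and another covers the search inside it.
  let A : Set (ℤ → Bool) := {u | ∃ d ∈ Finset.Icc (0 : ℤ) (2 * (r : ℤ) ^ (K + m)),
    ∀ k, -(r : ℤ) ^ m ≤ k → k < (r : ℤ) ^ m → u (d + k) = w k}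
  have hA : IsClosed A := by
    have : A = ⋃ d ∈ Finset.Icc (0 : ℤ) (2 * (r : ℤ) ^ (K + m)),
        {u | ∀ k, -(r : ℤ) ^ m ≤ k → k < (r : ℤ) ^ m → u (d + k) = w k} := by
      ext u
      simp [A]
    rw [this]
    refine isClosed_biUnion_finset fun d _ => ?_
    simp only [ofPred_forall]
    exact isClosed_iInter fun k => isClosed_iInter fun _ => isClosed_iInter fun _ =>
      isClosed_eq (continuous_apply _) continuous_const
  have hzA : shiftOrbit z ⊆ A := by
    rintro _ ⟨t, rfl⟩
    let N := t / (r : ℤ) ^ (K + m) + 1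
    have hN1 : t < N * (r : ℤ) ^ (K + m) := Int.lt_ediv_add_one_mul_self t hB
    have hN2 : N * (r : ℤ) ^ (K + m) ≤ t + (r : ℤ) ^ (K + m) := by
      have := Int.ediv_mul_le t hB.ne'
      simp only [N, add_mul, one_mul]
      omega
    -- The sign `s` records whether block `N` is dual to block `0`.
    obtain ⟨k, hk, hkK, h1, h0⟩ := hK (xor (z 0) (z N))
    have e1 := hz.block (by omega) hd hz N 0 K (k - 1) (by omega) (by omega)
    have e0 := hz.block (by omega) hd hz N 0 K k (by omega) hkK
    have f1 : z (N * (r : ℤ) ^ K + k - 1) = w (-1) := by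
      rw [← h1, add_sub_assoc, ← Bool.xor_assoc]
      simp only [zero_mul, zero_add] at e1
      rw [← e1]
      simp
    have f0 : z (N * (r : ℤ) ^ K + k) = w 0 := by
      rw [← h0, ← Bool.xor_assoc]
      simp only [zero_mul, zero_add] at e0
      rw [← e0]
      simp
    have hkB : k * (r : ℤ) ^ m ≤ (r : ℤ) ^ (K + m) := by
      rw [pow_add]
      exact mul_le_mul_of_nonneg_right hkK.le (by positivity)
    have hk0 : 0 ≤ k * (r : ℤ) ^ m := by positivity
    refine ⟨(N * (r : ℤ) ^ K + k) * (r : ℤ) ^ m - t, ?_, fun l hl hl' => ?_⟩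
    · rw [Finset.mem_Icc, add_mul, mul_assoc, ← pow_add]
      constructor <;> omega
    · have := hz.eq_of_eq hr hd hw m f1 f0 hl hl'
      rw [← this]
      change z (_ + t) = _
      congr 1
      ring
  obtain ⟨d, -, h⟩ := closure_minimal hzA hA y.2
  exact ⟨d, h⟩

end Substitution

/-! ### The idempotent `g₁` -/

/-- The elements of the Ellis semigroup commute with the exchange of the letters. -/
theorem ellisSemigroup_dual {z : ℤ → Bool} {f : orbitClosure z → orbitClosure z}
    (hf : f ∈ ellisSemigroup (orbitShift z) univ) {x y : orbitClosure z}
    (h : ∀ k, y.1 k = !(x.1 k)) (k : ℤ) : (f y).1 k = !((f x).1 k) := by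
  refine closure_minimal (s := {f | ∃ n ∈ (univ : Set ℤ), f = ⇑(orbitShift z ^ n)})
    (t := {f | (f y).1 k = !((f x).1 k)}) ?_
    (isClosed_eq (continuous_coord y k) 
      ((continuous_of_discreteTopology (f := not)).comp (continuous_coord x k))) hf
  rintro _ ⟨n, -, rfl⟩
  change ((orbitShift z ^ n) y).1 k = !(((orbitShift z ^ n) x).1 k)
  rw [orbitShift_zpow_apply, orbitShift_zpow_apply, h]

section Substitution

variable {r : ℕ} {θ : Bool → Fin r → Bool}

theorem IsContinuousSubst.exists_isG1 (hθ : IsContinuousSubst θ) (hstd : IsStandardForm θ)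
    {j : Fin r} (hj : θ false j = true) {z : ℤ → Bool} (hz : IsBiFixed θ z) :
    ∃ g, IsG1 θ z g := by
  have hd := hθ.2
  have hr : 1 < r := by have := hstd.one_lt hj; omega
  let D : Set (orbitClosure z → orbitClosure z) := {g | ∀ x y : orbitClosure z,
    IsBiFixed θ x.1 → IsBiFixed θ y.1 → y.1 0 = x.1 0 → y.1 (-1) = x.1 0 → g x = y}
  obtain ⟨f, hfE, hfD⟩ : ∃ f ∈ ellisSemigroup (orbitShift z) univ, f ∈ D := by
    obtain ⟨N, hN, hN1, hN0⟩ := hz.exists_pair hθ hstd hj (z 0) (z 0)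
    obtain ⟨f, hfE, hf⟩ := exists_mem_ellisSemigroup_of_tendsto (orbitShift z)
      fun m => N * (r : ℤ) ^ m
    refine ⟨f, hfE, fun x y hx hy h0 h1 => hf x y (tendsto_zpow_of_window hr ?_)⟩
    obtain ⟨M, hM⟩ := exists_abs_lt_pow hr N
    rw [abs_lt] at hM
    have e1 := hx.block (by omega) hd hz 0 0 M (N - 1) (by omega) (by omega)
    have e0 := hx.block (by omega) hd hz 0 0 M N (by omega) hM.2
    simp only [zero_mul, zero_add, hN1, hN0, bne_self_eq_false,
      bne_eq_false_iff_eq] at e1 e0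
    -- Positions `N - 1` and `N` lie in one block with `0`, so `x` has the letter `x 0` at both.
    exact fun m k hk hk' => hx.eq_of_eq hr hd hy m (e1.trans h1.symm) (e0.trans h0.symm) hk hk'
  obtain ⟨L, hLK, hLc, hL⟩ := exists_isMinimalLeftIdealOf_subset (orbitShift z)
    (isClosed_image_comp (orbitShift z) f) (isLeftIdealOf_comp (orbitShift z) hfE)
  -- Elements of `L` have the form `q₁ ∘ f`; some `q₂` returns `q₁ W` to `W`, and by duality `q₁ W'`
  -- to `W'`.
  have hLD : (L ∩ D).Nonempty := by
    obtain ⟨q, hqL⟩ := hL.1.2.1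
    obtain ⟨q₁, hq₁, rfl⟩ := hLK hqL
    obtain ⟨w, hw, hw1, hw0⟩ := hz.exists_of_letters hd false false
    obtain ⟨w', hw', hw1', hw0'⟩ := hz.exists_of_letters hd true true
    let W : orbitClosure z := ⟨w, hz.mem_orbitClosure hθ hstd hj hw⟩
    let W' : orbitClosure z := ⟨w', hz.mem_orbitClosure hθ hstd hj hw'⟩
    have hdual : ∀ k, W'.1 k = !(W.1 k) := by
      intro k
      obtain ⟨m, hm⟩ := exists_abs_lt_pow hr k
      rw [abs_lt] at hm
      change w' k = !(w k)
      rcases le_or_gt 0 k with h | h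
      · have := hw.block (by omega) hd hw' 0 0 m k h hm.2
        simp only [zero_mul, zero_add, hw0, hw0'] at this
        simpa using this.symm
      · have := hw.block (by omega) hd hw' (-1) (-1) m (k + (r : ℤ) ^ m) (by omega) (by omega)
        rw [show (-1) * (r : ℤ) ^ m + (k + (r : ℤ) ^ m) = k by ring, hw1, hw1'] at this
        simpa using this.symm
    choose d hd' using hz.exists_window hθ hstd hj hw (q₁ W)
    obtain ⟨q₂, hq₂, hlim⟩ := exists_mem_ellisSemigroup_of_tendsto (orbitShift z) d
    have hW : q₂ (q₁ W) = W := hlim _ _ (tendsto_zpow_of_window hr hd')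
    have hq := comp_mem_ellisSemigroup _ hq₂ hq₁
    have hW' : q₂ (q₁ W') = W' := by
      refine Subtype.ext (funext fun k => ?_)
      have := ellisSemigroup_dual hq hdual k
      rw [hdual, ← congrArg (fun u : orbitClosure z => u.1 k) hW]
      exact this
    refine ⟨q₂ ∘ q₁ ∘ f, hL.1.2.2 _ hq₂ _ hqL, fun x y hx hy h0 h1 => ?_⟩
    have hf : f x = y := hfD x y hx hy h0 h1
    change q₂ (q₁ (f x)) = y
    rw [hf]
    cases hb : x.1 0
    · have : y = W := Subtype.ext
        (hy.ext hr hd hw (h1.trans (hb.trans hw1.symm)) (h0.trans (hb.trans hw0.symm)))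
      rw [this, hW]
    · have : y = W' := Subtype.ext
        (hy.ext hr hd hw' (h1.trans (hb.trans hw1'.symm)) (h0.trans (hb.trans hw0'.symm)))
      rw [this, hW']
  have hDc : IsClosed D := by
    simp only [D, ofPred_forall]
    exact isClosed_iInter fun x => isClosed_iInter fun y => isClosed_iInter fun _ =>
      isClosed_iInter fun _ => isClosed_iInter fun _ => isClosed_iInter fun _ =>
      isClosed_eq (continuous_apply x) continuous_const
  obtain ⟨g, hg, hgg⟩ := exists_idempotent_of_isClosed hLD (hLc.inter hDc)
    (fun p hp q hq => ⟨hL.1.2.2 p (hL.1.1 hp.1) q hq.1, fun x y hx hy h0 h1 => by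
      have hqx : q x = y := hq.2 x y hx hy h0 h1
      change p (q x) = y
      rw [hqx]
      exact hp.2 y y hy hy rfl (h1.trans h0.symm)⟩)
  exact ⟨g, ⟨hgg, L, hL, hg.1⟩, hg.2⟩

/-! ### The generating set -/

theorem mul_sum_pow_lt {R p : ℤ} (hR : 1 < R) (hpR : p < R) {M : Finset ℕ} {a : ℕ}
    (h : ∀ m ∈ M, m < a) : p * ∑ m ∈ M, R ^ m < R ^ a := by
  have h1 : ∑ m ∈ M, R ^ m ≤ ∑ m ∈ Finset.range a, R ^ m :=
    Finset.sum_le_sum_of_subset_of_nonneg (fun m hm => Finset.mem_range.2 (h m hm))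
      fun m _ _ => by positivity
  have h0 : 0 ≤ ∑ m ∈ M, R ^ m := Finset.sum_nonneg fun m _ => by positivity
  have h2 := geom_sum_mul R a
  nlinarith

/-- Induction on the largest exponent `a`. As `w p = 0`, block `p` of length `R ^ a`, `R = r ^ 2`,
copies block `0`, which contains the sum of the smaller terms. For a single term, the letter is the
last of block `p - 1`, and `w (p - 1) = 1` by minimality of `j`. -/
theorem IsBiFixed.apply_sum_sub_one (hd : ∀ i, θ false i = !(θ true i))
    (hstd : IsStandardForm θ) {j : Fin r} (hj : IsLeast {i : Fin r | θ false i = true} j)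
    {w : ℤ → Bool} (hw : IsBiFixed θ w) (h1 : w (-1) = false) (h0 : w 0 = false)
    (M : Finset ℕ) (hM : M.Nonempty) :
    w (((j : ℤ) * r + j) * ∑ m ∈ M, ((r : ℤ) ^ 2) ^ m - 1) = true := by
  obtain ⟨hj0, hjr⟩ := hstd.one_lt hj.1
  have hjt : θ false j = true := hj.1
  have hr : 0 < r := by omega
  have hjw : w j = true := by
    have := hw.apply_xor hd 0 j
    simpa [hjt, h0] using this
  have hp0 : (0 : ℤ) < (j : ℤ) * r + j := by positivity
  have hpR : (j : ℤ) * r + j < (r : ℤ) ^ 2 := by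
    have : (j : ℤ) + 1 < r := by exact_mod_cast hjr
    nlinarith
  have hR : (1 : ℤ) < (r : ℤ) ^ 2 := by omega
  have hwp : w ((j : ℤ) * r + j) = false := by
    rw [mul_comm, hw.apply_xor hd, hjw, hjt]
    rfl
  have hwp1 : w ((j : ℤ) * r + j - 1) = true := by
    have hlt : (⟨(j : ℕ) - 1, by omega⟩ : Fin r) < j := by
      rw [Fin.lt_def]
      simp only
      omega
    have hi : θ false ⟨(j : ℕ) - 1, by omega⟩ = false := by
      by_contra h
      exact absurd (hj.2 (by simpa using h)) (not_le.2 hlt)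
    have := hw.apply_xor hd j ⟨(j : ℕ) - 1, by omega⟩
    rw [hi, hjw] at this
    rw [show (j : ℤ) * r + j - 1 = r * j + ((j - 1 : ℕ) : ℤ) by push_cast [hj0]; ring]
    exact this
  induction M using Finset.induction_on_max with
  | empty => exact absurd hM Finset.not_nonempty_empty
  | insert a s hs ih =>
    rw [Finset.sum_insert fun h => (hs a h).false, mul_add]
    set p := (j : ℤ) * r + j
    have hpos : (0 : ℤ) < ((r : ℤ) ^ 2) ^ a := by positivity
    rcases s.eq_empty_or_nonempty with rfl | hne
    -- Compared with block `-1`, whose last letter equals its index letter `w (-1)`.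
    · have := hw.block hr hd hw (p - 1) (-1) (2 * a) ((r : ℤ) ^ (2 * a) - 1)
        (by rw [pow_mul]; omega) (by omega)
      rw [pow_mul, hwp1, h1,
        show (p - 1) * ((r : ℤ) ^ 2) ^ a + (((r : ℤ) ^ 2) ^ a - 1) = p * ((r : ℤ) ^ 2) ^ a - 1
          by ring,
        show (-1) * ((r : ℤ) ^ 2) ^ a + (((r : ℤ) ^ 2) ^ a - 1) = -1 by ring, h1] at this
      simpa using this
    · have hlt := mul_sum_pow_lt hR hpR hs
      have hge : 0 < p * ∑ m ∈ s, ((r : ℤ) ^ 2) ^ m :=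
        mul_pos hp0 (Finset.sum_pos (fun m _ => by positivity) hne)
      have := hw.block hr hd hw p 0 (2 * a) (p * ∑ m ∈ s, ((r : ℤ) ^ 2) ^ m - 1)
        (by omega) (by rw [pow_mul]; omega)
      rw [pow_mul, hwp, zero_mul, zero_add, ih hne, h0] at this
      rw [add_sub_assoc]
      simpa using this

end Substitution

theorem exists_sum_of_finiteSums {R p : ℤ} (hR : 1 < R) (hp : p ≠ 0) {n : ℤ}
    (hn : n ∈ finiteSums (range fun m : ℕ => p * R ^ m)) :
    ∃ M : Finset ℕ, M.Nonempty ∧ n = p * ∑ m ∈ M, R ^ m := by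
  classical
  obtain ⟨F, hF, hFQ, rfl⟩ := hn
  rw [← image_univ, Finset.subset_set_image_iff] at hFQ
  obtain ⟨M, -, rfl⟩ := hFQ
  refine ⟨M, Finset.image_nonempty.1 hF, ?_⟩
  rw [Finset.sum_image, Finset.mul_sum]
  intro a _ b _ h
  exact Int.pow_right_injective (by omega) (mul_left_cancel₀ hp h)

/-- An IP set contains its generators, so it is never empty. -/
theorem not_isIPCP {X : Type*} [TopologicalSpace X] {T : X ≃ₜ X} {S P : Set ℤ} {f : X → X}
    {U : Set (X → X)} (hU : U ∈ 𝓝 f) (h : ∀ n ∈ P, ⇑(T ^ n) ∉ U) : ¬ IsIPCP T S P f := by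
  rintro ⟨-, hf⟩
  obtain ⟨_, ⟨G, hG, rfl⟩, hQ⟩ := hf U hU
  obtain ⟨n, hn⟩ := hG.nonempty
  have := @hQ n ⟨{n}, Finset.singleton_nonempty n, by simpa using hn, by simp⟩
  exact h n this.1 this.2

/-! ### The counterexample -/

theorem mainTheorem3 {r : ℕ} (θ : Bool → Fin r → Bool)
    (hθ : IsContinuousSubst θ) (hstd : IsStandardForm θ)
    (z : ℤ → Bool) (hz : IsBiFixed θ z)
    (j : Fin r) (hj : IsLeast {i : Fin r | θ false i = true} j)
    (p : ℤ) (hp : p = (j : ℤ) * r + j)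
    (Q G : Set ℤ) (hQ : Q = {n : ℤ | ∃ m : ℕ, n = p * (r : ℤ) ^ (2 * m)})
    (hG : G = {n : ℤ | n < 0} ∪ Q) :
    -- the four bi-infinite fixed points of `θ`, all of which lie in the substitution space
    (∀ a b : Bool, ∃! x : ℤ → Bool, IsBiFixed θ x ∧ x (-1) = a ∧ x 0 = b) ∧
    (∀ x : ℤ → Bool, IsBiFixed θ x → x ∈ orbitClosure z) ∧
    -- the generating sets
    Q.Infinite ∧ G ∩ Ioi 0 = Q ∧ G ∩ Iio 0 = {n : ℤ | n < 0} ∧ finiteSums G = univ ∧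
    -- the idempotent
    (∃ g, IsG1 θ z g) ∧
    ∀ g, IsG1 θ z g →
      (¬ IsIPCP (orbitShift z) univ (finiteSums Q) g ∧
        ¬ IsIPCP (orbitShift z) (Ici 0) (finiteSums Q) g) ∧
      (∀ N : Set ℤ, IsIPSet N → N ⊆ {n : ℤ | n < 0} →
        ¬ IsIPCP (orbitShift z) univ N g ∧ ¬ IsIPCP (orbitShift z) (Iic 0) N g) ∧
      IsIPCP (orbitShift z) univ univ g ∧
      ¬ HaddadJohnsonEquivalence (orbitShift z) G g := by
  have hd := hθ.2
  have hjt : θ false j = true := hj.1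
  obtain ⟨hj0, hjr⟩ := hstd.one_lt hjt
  have hr : 1 < r := by omega
  have hr0 : (0 : ℤ) < r := by omega
  have hp0 : 0 < p := by rw [hp]; positivity
  have hR : (1 : ℤ) < (r : ℤ) ^ 2 := by
    exact_mod_cast Nat.one_lt_pow two_ne_zero hr
  have hQr : Q = range fun m : ℕ => p * ((r : ℤ) ^ 2) ^ m := by
    rw [hQ]
    ext n
    simp [pow_mul, eq_comm]
  have hQpos : ∀ n ∈ Q, 0 < n := by
    rw [hQr]
    rintro _ ⟨m, rfl⟩
    positivity
  have hQinf : Q.Infinite := by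
    rw [hQr]
    refine infinite_range_of_injective fun a b h => ?_
    exact Int.pow_right_injective (by omega) (mul_left_cancel₀ hp0.ne' h)
  have hGpos : G ∩ Ioi 0 = Q := by
    ext n
    rw [hG]
    constructor
    · rintro ⟨h | h, h'⟩
      · exact absurd h' (lt_asymm (show n < 0 from h))
      · exact h
    · exact fun h => ⟨Or.inr h, hQpos n h⟩
  have hGneg : G ∩ Iio 0 = {n : ℤ | n < 0} := by
    ext n
    rw [hG]
    constructor
    · exact fun h => h.2
    · exact fun h => ⟨Or.inl h, h⟩
  have hGsums : finiteSums G = univ := by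
    refine eq_univ_of_forall fun n => ?_
    rcases lt_or_ge n 0 with h | h
    · exact ⟨{n}, Finset.singleton_nonempty n, by simpa [hG] using Or.inl h, by simp⟩
    -- A nonnegative `n` is `q + (n - q)` with `q ∈ Q` so large that `n - q` is negative.
    · obtain ⟨q, hq, hqn⟩ : ∃ q ∈ Q, n < q := by
        by_contra! hno
        exact hQinf ((finite_Icc 0 n).subset fun q hq => ⟨(hQpos q hq).le, hno q hq⟩)
      refine ⟨{q, n - q}, Finset.insert_nonempty _ _, ?_, ?_⟩
      · intro m hm
        rw [hG]
        simp only [Finset.coe_insert, Finset.coe_singleton, mem_insert_iff,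
          mem_singleton_iff] at hm
        rcases hm with rfl | rfl
        · exact Or.inr hq
        · exact Or.inl (show n - q < 0 by omega)
      · rw [Finset.sum_pair (by have := hQpos q hq; omega)]
        ring
  refine ⟨fun a b => ?_, fun x hx => hz.mem_orbitClosure hθ hstd hjt hx, hQinf, hGpos, hGneg,
    hGsums, hθ.exists_isG1 hstd hjt hz, fun g hg => ?_⟩
  · obtain ⟨x, hx, hxa, hxb⟩ := hz.exists_of_letters hd a b
    exact ⟨x, ⟨hx, hxa, hxb⟩, fun y hy =>
      hy.1.ext hr hd hx (hy.2.1.trans hxa.symm) (hy.2.2.trans hxb.symm)⟩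
  obtain ⟨w, hw, hw1, hw0⟩ := hz.exists_of_letters hd false false
  obtain ⟨v, hv, hv1, hv0⟩ := hz.exists_of_letters hd true false
  let W : orbitClosure z := ⟨w, hz.mem_orbitClosure hθ hstd hjt hw⟩
  let V : orbitClosure z := ⟨v, hz.mem_orbitClosure hθ hstd hjt hv⟩
  have hgW : g W = W := hg.2 W W hw hw rfl (hw1.trans hw0.symm)
  have hgV : g V = W := hg.2 V W hv hw (hw0.trans hv0.symm) (hw1.trans hv0.symm)
  have hVW : V ≠ W := fun h => by
    have : v (-1) = w (-1) := congrArg (fun u : orbitClosure z => u.1 (-1)) h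
    rw [hv1, hw1] at this
    exact absurd this (by decide)
  have hopen : ∀ (x : orbitClosure z) (k : ℤ) (b : Bool), (g x).1 k = b →
      {f : orbitClosure z → orbitClosure z | (f x).1 k = b} ∈ 𝓝 g := fun x k b h =>
    ((isOpen_discrete {b}).preimage (continuous_coord x k)).mem_nhds h
  have hpos : ∀ S, ¬ IsIPCP (orbitShift z) S (finiteSums Q) g := by
    intro S
    refine not_isIPCP (hopen W (-1) false (by rw [hgW]; exact hw1)) fun n hn hU => ?_
    rw [hQr] at hn
    obtain ⟨M, hM, rfl⟩ := exists_sum_of_finiteSums hR hp0.ne' hn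
    have h := hw.apply_sum_sub_one hd hstd hj hw1 hw0 M hM
    have hU' : ((orbitShift z ^ (p * ∑ m ∈ M, ((r : ℤ) ^ 2) ^ m)) W).1 (-1) = false := hU
    rw [orbitShift_zpow_apply, neg_add_eq_sub, hp] at hU'
    exact absurd (h.symm.trans hU') (by decide)
  have hneg : ∀ S N, N ⊆ {n : ℤ | n < 0} → ¬ IsIPCP (orbitShift z) S N g := by
    intro S N hN
    refine not_isIPCP (Filter.inter_mem (hopen W 0 false (by rw [hgW]; exact hw0))
      (hopen V 0 false (by rw [hgV]; exact hw0))) fun n hn hU => ?_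
    have hn0 : n < 0 := hN hn
    have hUW : ((orbitShift z ^ n) W).1 0 = false := hU.1
    have hUV : ((orbitShift z ^ n) V).1 0 = false := hU.2
    rw [orbitShift_zpow_apply, zero_add] at hUW hUV
    change w n = false at hUW
    change v n = false at hUV
    obtain ⟨m, hm⟩ := exists_abs_lt_pow hr n
    rw [abs_lt] at hm
    -- The left halves of `v` and `w` are dual, so both cannot have `0` at `n`.
    have := hw.block (by omega) hd hv (-1) (-1) m (n + (r : ℤ) ^ m) (by omega) (by omega)
    rw [show (-1) * (r : ℤ) ^ m + (n + (r : ℤ) ^ m) = n by ring, hw1, hv1, hUW, hUV] at this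
    exact absurd this (by decide)
  have huniv : IsIPCP (orbitShift z) univ univ g := by
    obtain ⟨hgg, L, hL, hgL⟩ := hg.1
    -- Powers of the shift are injective, while `g` identifies `V` and `W`.
    exact isIPCP_univ_of_idempotent _ (hL.1.1 hgL) hgg fun n hn =>
      hVW ((orbitShift z ^ n).injective (by rw [hn, hgW, hgV]))
  refine ⟨⟨hpos _, hpos _⟩, fun N _ hN => ⟨hneg _ N hN, hneg _ N hN⟩, huniv, fun hHJ => ?_⟩
  rw [HaddadJohnsonEquivalence, hGsums, hGpos, hGneg] at hHJ
  rcases hHJ.1 huniv with ⟨-, h⟩ | ⟨-, h⟩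
  · exact hpos _ h
  · refine hneg _ _ ?_ h
    rintro _ ⟨F, hF, hFn, rfl⟩
    have hF0 : ∀ m ∈ F, m < 0 := fun m hm => hFn hm
    exact Finset.sum_neg hF0 hF
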